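/- A two-unicast-$Z$ network is a finite directed acyclic multigraph $\mathcal G=(\mathcal V,\mathcal E)$ of unit-capacity edges with four distinct marked nodes, Source $1$, Source $2$, Destination $1$, Destination $2$. Write $\mathcal S_i$ for the set of edges entering Source $i$ (message edges, preceded by no edge), $\mathcal T_i$ for the set of edges leaving Destination $i$ (output edges, followed by no edge), $\mathrm{Out}(\mathcal S_i)$ for the set of edges leaving Source $i$, and $\mathrm{In}(e)$ for the set of edges whose head is the tail of $e$. Source $i$ has a message $W_i$ which Destination $i$ must recover; Destination $2$ knows $W_1$ in advance. A code of rate $(R_1,R_2)$, $R_i\ge 0$, with alphabet $\mathcal A$ and block length $n\ge 1$ has messages $W_i\in\mathcal A^{\lceil nR_i\rceil}$ and consists of encoding functions $f_e:\mathcal A^{\lceil nR_i\rceil}\to\mathcal A^n$ for $e\in\mathrm{Out}(\mathcal S_i)$, functions $f_e:\mathcal A^{n|\mathrm{In}(e)|}\to\mathcal A^n$ for the edges $e$ outside all $\mathcal S_i$, $\mathrm{Out}(\mathcal S_i)$, $\mathcal T_i$, and decoding functions $g_t:\mathcal A^{n|\mathrm{In}(t)|}\to\mathcal A^n$ for $t\in\mathcal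 T_1$ and $g_t:\mathcal A^{n|\mathrm{In}(t)|}\times\mathcal A^{\lceil nR_1\rceil}\to\mathcal A^n$ for $t\in\mathcal T_2$, the last argument being $W_1$; each symbol of $W_i$ is read off at a fixed position of the blocks put out on $\mathcal T_i$. The rate $(R_1,R_2)$ is zero-error achievable if, for some finite alphabet with $|\mathcal A|\ge 2$ and some $n\ge1$, there is such a code that recovers $(W_1,W_2)$ correctly for all values of the messages. It is zero-error achievable by a linear code if there is such a zero-error code whose alphabet is a field $\mathbb K$ and all of whose encoding and decoding functions are $\mathbb K$-linear; here any field $\mathbb K$ and any block length (vector dimension) $n\ge 1$ are allowed. The zero-error rate region is the closure of the set of zero-error achievable rates, and the zero-error capacity is its supremum in the componentwise order. **Theorem.** There exists a two-unicast-$Z$ network, with $|\mathcal S_1|=|\mathcal T_1|=|\mathcal S_2|=|\mathcal T_2|=10$, in which the rate $(10,10)$ is zero-error achievable (hence by a non-linear code), but is not zero-error achievable by any linear code. Moreover $(10,10)$ is the zero-error capacity of this network, so that linear codes are insufficient to achieve the zero-error capacity. -/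

import Mathlib

open scoped NNReal

/-- A two-unicast-Z network: a finite directed acyclic multigraph with edge set `E`, every edge
having unit capacity, in which the two source nodes and the two destination nodes are marked.
Destination 2 knows the message of source 1; this side information appears in the codes below. -/
structure TwoUnicastZ where
  V : Type
  E : Type
  finite_V : Finite V
  finite_E : Finite E
  tail : E → V
  head : E → V
  acyclic : ∀ e, ¬ Relation.TransGen (fun e e' => head e = tail e') e e
  source1 : V
  source2 : V
  dest1 : V
  dest2 : V
  /-- The four marked nodes are distinct. -/
  nodup : [source1, source2, dest1, dest2].Nodup
  /-- The edges entering a source are message edges: nothing precedes them. -/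
  source_root : ∀ e, head e = source1 ∨ head e = source2 → ∀ e', head e' ≠ tail e
  /-- The edges leaving a destination are output edges: nothing follows them. -/
  dest_terminal : ∀ e, tail e = dest1 ∨ tail e = dest2 → ∀ e', tail e' ≠ head e

namespace TwoUnicastZ

variable (N : TwoUnicastZ)

/-- The edges of the first source: the edges entering the node `source1`. -/
def S1 : Set N.E := {e | N.head e = N.source1}

/-- The edges of the second source: the edges entering the node `source2`. -/
def S2 : Set N.E := {e | N.head e = N.source2}

/-- The edges of the first destination: the edges leaving the node `dest1`. -/
def T1 : Set N.E := {e | N.tail e = N.dest1}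

/-- The edges of the second destination: the edges leaving the node `dest2`. -/
def T2 : Set N.E := {e | N.tail e = N.dest2}

/-- `Out(S1)`: the edges leaving the node `source1`. -/
def Out1 : Set N.E := {e | N.tail e = N.source1}

/-- `Out(S2)`: the edges leaving the node `source2`. -/
def Out2 : Set N.E := {e | N.tail e = N.source2}

/-- The remaining edges, which are neither source edges, nor leave a source, nor are destination
edges. -/
def RelayEdge : Set N.E := (N.S1 ∪ N.S2 ∪ N.Out1 ∪ N.Out2 ∪ N.T1 ∪ N.T2)ᶜ

/-- `In(e)`: the edges whose head is the tail of `e`. -/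
def In (e : N.E) : Set N.E := {e' | N.head e' = N.tail e}

/-- The messages of rate `R` for block length `n` over the alphabet `A`: `⌈n R⌉` symbols. -/
abbrev Msg (A : Type) (n : ℕ) (R : ℝ≥0) : Type := Fin ⌈(n : ℝ≥0) * R⌉₊ → A

/-- A code of rate `(R1, R2)` over the alphabet `A` with block length `n`: every edge carries a
block of `n` symbols. The decoders at destination 2 have the message of source 1 as an additional
argument. The maps `place1`, `place2` say where, among the blocks put out on the destination edges,
each message symbol is to be read off. -/
structure Code (A : Type) (n : ℕ) (R1 R2 : ℝ≥0) where
  enc1 : N.Out1 → Msg A n R1 → (Fin n → A)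
  enc2 : N.Out2 → Msg A n R2 → (Fin n → A)
  relay : ∀ e : N.RelayEdge, (N.In e → Fin n → A) → (Fin n → A)
  dec1 : ∀ t : N.T1, (N.In t → Fin n → A) → (Fin n → A)
  dec2 : ∀ t : N.T2, (N.In t → Fin n → A) × Msg A n R1 → (Fin n → A)
  place1 : Fin ⌈(n : ℝ≥0) * R1⌉₊ → N.T1 × Fin n
  place2 : Fin ⌈(n : ℝ≥0) * R2⌉₊ → N.T2 × Fin n

namespace Code

variable {N} {A : Type} {n : ℕ} {R1 R2 : ℝ≥0}

/-- `x e` is the block carried by the edge `e` when the messages are `w1` and `w2`. As the graph is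
acyclic, the code and the messages determine these blocks on all edges outside `S1 ∪ S2`, and the
blocks on `S1 ∪ S2` are not used (the nodes `source1`, `source2` have the messages themselves). -/
structure IsRun (c : N.Code A n R1 R2) (w1 : Msg A n R1) (w2 : Msg A n R2)
    (x : N.E → Fin n → A) : Prop where
  enc1 : ∀ e : N.Out1, x e = c.enc1 e w1
  enc2 : ∀ e : N.Out2, x e = c.enc2 e w2
  relay : ∀ e : N.RelayEdge, x e = c.relay e (fun e' => x e')
  dec1 : ∀ t : N.T1, x t = c.dec1 t (fun e' => x e')
  dec2 : ∀ t : N.T2, x t = c.dec2 t (fun e' => x e', w1)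

/-- Zero error: whatever the two messages are, the destination edges put out `w1` at destination 1
and `w2` at destination 2. -/
def ZeroError (c : N.Code A n R1 R2) : Prop :=
  ∀ (w1 : Msg A n R1) (w2 : Msg A n R2), ∃ x : N.E → Fin n → A, c.IsRun w1 w2 x ∧
    (∀ k, x (c.place1 k).1 (c.place1 k).2 = w1 k) ∧
    (∀ k, x (c.place2 k).1 (c.place2 k).2 = w2 k)

/-- A code whose alphabet is a field `K` is linear if all its encoding and decoding functions
are `K`-linear (scalar linear for `n = 1`, vector linear with vectors of dimension `n` for
`n > 1`). -/
structure IsLinear {K : Type} [Field K] (c : N.Code K n R1 R2) : Prop where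
  enc1 : ∀ e, IsLinearMap K (c.enc1 e)
  enc2 : ∀ e, IsLinearMap K (c.enc2 e)
  relay : ∀ e, IsLinearMap K (c.relay e)
  dec1 : ∀ t, IsLinearMap K (c.dec1 t)
  dec2 : ∀ t, IsLinearMap K (c.dec2 t)

end Code

/-- The rate `(R1, R2)` is zero-error achievable: some code over some finite alphabet with at least
two symbols and with some positive block length attains it without error. -/
def ZeroErrorAchievable (R1 R2 : ℝ≥0) : Prop :=
  ∃ (A : Type) (_ : Finite A) (_ : Nontrivial A) (n : ℕ) (_ : 0 < n) (c : N.Code A n R1 R2),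
    c.ZeroError

/-- The rate `(R1, R2)` is zero-error achievable by a linear code, over some field and with vectors
of some positive dimension. -/
def LinearlyZeroErrorAchievable (R1 R2 : ℝ≥0) : Prop :=
  ∃ (K : Type) (_ : Field K) (n : ℕ) (_ : 0 < n) (c : N.Code K n R1 R2),
    c.IsLinear ∧ c.ZeroError

/-- The zero-error rate region: the closure of the set of zero-error achievable rates. -/
def zeroErrorRegion : Set (ℝ≥0 × ℝ≥0) :=
  closure {R | N.ZeroErrorAchievable R.1 R.2}

/-- `C` is the zero-error capacity: the supremum of the zero-error rate region, in the
componentwise order on rate pairs. -/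
def IsZeroErrorCapacity (C : ℝ≥0 × ℝ≥0) : Prop := IsLUB N.zeroErrorRegion C

end TwoUnicastZ

/-!
The network consists of two unrelated parts, fed by the messages of source 2: a Fano network, which
a linear code can serve only in characteristic two, and two copies of a non-Fano network sharing
the message 7, which a linear code can serve only in a characteristic other than two. In the
non-Fano part, a terminal sees sums `a + b`, `a + c`, `b + c`, hence `2 c`, for each copy. Over 2-bit words both
parts can be served at once if the Fano network adds bitwise and the non-Fano networks add modulo 4:
the doubled message yields one of its bits, and since the second copy uses the bit reversal of the
message, it yields the other one (`twist_double`).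

These parts are problems with ten demands, which have to be turned into demands of only two
destinations. Source 1 emits ten signals `u i`, and `m i` masks a message of source 2 by `u i`.
Destination 2 knows the masks and receives the masked messages; destination 1 has to recover each
mask `u i` from `m i` and from those signals `obs i` that are available for the `i`-th demand.
Both destinations are used to capacity, so what destination 1 receives is in bijection with the
masks whatever source 2 emits (`exists_linear_rules`); this forces the `i`-th demand to be met from
`obs i` (`decodable_of_obs`). The message 7 has three demands; it is masked three times in
a row by `m 7`, `m 8`, `m 9`, and the demands for the latter two are given the earlier masks.

Signals are turned into edges by splitting: each signal is one bottleneck edge `wire x`, and copies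
of it are distributed from the head of that edge (`WireSystem.network`). The linear algebra
of the two parts is `add_self_eq_zero_of_fano` and `exists_eq_zero_of_nonFano`. The capacity is
`(10, 10)` because no two message symbols can be read off at the same place of the ten output edges.
-/

/-! ### Networks described by their signals -/

/-- The signals of a network with `k` signals emitted by each source and further signals indexed
by `J`, which are computed inside the network. -/
inductive Wire (k : ℕ) (J : Type) where
  | u (i : Fin k)
  | v (i : Fin k)
  | inner (j : J)
  deriving DecidableEq, Fintype

/-- A description of a network by its signals: the signal `inner j` is computed from the
signals in `dep j`, the destinations 1 and 2 receive the signals `out1 i` and `out2 i`. -/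
structure WireSystem (k : ℕ) where
  J : Type
  [fintypeJ : Fintype J]
  [decEqJ : DecidableEq J]
  dep : J → Finset (Wire k J)
  /-- A rank function, which makes the dependencies acyclic. -/
  rank : J → ℕ
  rank_lt : ∀ j j', Wire.inner j' ∈ dep j → rank j' < rank j
  out1 : Fin k → Wire k J
  out2 : Fin k → Wire k J

namespace WireSystem

variable {k : ℕ} (S : WireSystem k)

attribute [instance] WireSystem.fintypeJ WireSystem.decEqJ

/-- The nodes of the network of a wire system. A signal `inner j` is formed at `gather j` from its
inputs, and every signal `x` is distributed from `hub x`. -/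
inductive Vert where
  | root
  | sink
  | source1
  | source2
  | dest1
  | dest2
  | gather (j : S.J)
  | hub (x : Wire k S.J)

/-- The edges of the network of a wire system. The edge `wire x` is the bottleneck that makes `x` a
single signal; `copy`, `into1` and `into2` distribute signals from their hubs to the places where
they are used; `msg1`, `msg2` are the message edges and `put1`, `put2` the output edges. -/
inductive Edge where
  | msg1 (i : Fin k)
  | msg2 (i : Fin k)
  | put1 (i : Fin k)
  | put2 (i : Fin k)
  | wire (x : Wire k S.J)
  | copy (x : Wire k S.J) (j : S.J) (h : x ∈ S.dep j)
  | into1 (i : Fin k)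
  | into2 (i : Fin k)

/-- The node at which a signal is formed. -/
def origin : Wire k S.J → S.Vert
  | .u _ => .source1
  | .v _ => .source2
  | .inner j => .gather j

def edgeTail : S.Edge → S.Vert
  | .msg1 _ => .root
  | .msg2 _ => .root
  | .put1 _ => .dest1
  | .put2 _ => .dest2
  | .wire x => S.origin x
  | .copy x _ _ => .hub x
  | .into1 i => .hub (S.out1 i)
  | .into2 i => .hub (S.out2 i)

def edgeHead : S.Edge → S.Vert
  | .msg1 _ => .source1
  | .msg2 _ => .source2
  | .put1 _ => .sink
  | .put2 _ => .sink
  | .wire x => .hub x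
  | .copy _ j _ => .gather j
  | .into1 _ => .dest1
  | .into2 _ => .dest2

instance : Finite S.Vert := by
  let f : S.Vert → Fin 6 ⊕ S.J ⊕ Wire k S.J
    | .root => .inl 0
    | .sink => .inl 1
    | .source1 => .inl 2
    | .source2 => .inl 3
    | .dest1 => .inl 4
    | .dest2 => .inl 5
    | .gather j => .inr (.inl j)
    | .hub x => .inr (.inr x)
  refine Finite.of_injective f ?_
  intro a b h
  cases a <;> cases b <;> simp_all [f]

instance : Finite S.Edge := by
  let f : S.Edge → (Fin 6 × Fin k) ⊕ Wire k S.J ⊕ (Wire k S.J × S.J)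
    | .msg1 i => .inl (0, i)
    | .msg2 i => .inl (1, i)
    | .put1 i => .inl (2, i)
    | .put2 i => .inl (3, i)
    | .into1 i => .inl (4, i)
    | .into2 i => .inl (5, i)
    | .wire x => .inr (.inl x)
    | .copy x j _ => .inr (.inr (x, j))
  refine Finite.of_injective f ?_
  intro a b h
  cases a <;> cases b <;> simp_all [f]

/-- A height function on the nodes that increases along every edge. -/
def height : S.Vert → ℕ
  | .root => 0
  | .source1 => 1
  | .source2 => 1
  | .hub (.u _) => 2
  | .hub (.v _) => 2
  | .gather j => 2 * S.rank j + 3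
  | .hub (.inner j) => 2 * S.rank j + 4
  | .dest1 => 2 * Finset.univ.sup S.rank + 5
  | .dest2 => 2 * Finset.univ.sup S.rank + 5
  | .sink => 2 * Finset.univ.sup S.rank + 6

theorem height_hub_lt (x : Wire k S.J) :
    S.height (.hub x) < 2 * Finset.univ.sup S.rank + 5 := by
  rcases x with i | i | j
  · simp only [height]; omega
  · simp only [height]; omega
  · have := Finset.le_sup (f := S.rank) (Finset.mem_univ j)
    simp only [height]; omega

theorem height_lt (e : S.Edge) : S.height (S.edgeTail e) < S.height (S.edgeHead e) := by
  rcases e with i | i | i | i | x | ⟨x, j, h⟩ | i | i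
  · simp [edgeTail, edgeHead, height]
  · simp [edgeTail, edgeHead, height]
  · simp [edgeTail, edgeHead, height]
  · simp [edgeTail, edgeHead, height]
  · rcases x with i | i | j <;> simp [edgeTail, edgeHead, height, origin]
  · rcases x with i | i | j'
    · simp [edgeTail, edgeHead, height]
    · simp [edgeTail, edgeHead, height]
    · have := S.rank_lt j j' h
      simp only [edgeTail, edgeHead, height]; omega
  · exact S.height_hub_lt _
  · exact S.height_hub_lt _

/-- The two-unicast-Z network of a wire system. -/
def network : TwoUnicastZ where
  V := S.Vert
  E := S.Edge
  finite_V := inferInstance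
  finite_E := inferInstance
  tail := S.edgeTail
  head := S.edgeHead
  acyclic := by
    have key : ∀ e e', Relation.TransGen (fun e e' => S.edgeHead e = S.edgeTail e') e e' →
        S.height (S.edgeTail e) < S.height (S.edgeTail e') := by
      intro e e' h
      induction h with
      | single h => exact h ▸ S.height_lt _
      | tail _ h ih => exact ih.trans (h ▸ S.height_lt _)
    exact fun e h => lt_irrefl _ (key e e h)
  source1 := .source1
  source2 := .source2
  dest1 := .dest1
  dest2 := .dest2
  nodup := by simp
  source_root := by
    intro e he e'
    rcases e with i | i | i | i | x | ⟨x, j, h⟩ | i | i <;> simp [edgeHead] at he <;>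
      rcases e' with i | i | i | i | x | ⟨x, j, h⟩ | i | i <;> simp [edgeHead, edgeTail]
  dest_terminal := by
    intro e he e'
    rcases e with i | i | i | i | (x | x | x) | ⟨x, j, h⟩ | i | i <;>
      simp [edgeTail, origin] at he <;>
      rcases e' with i | i | i | i | (x | x | x) | ⟨x, j, h⟩ | i | i <;>
      simp [edgeHead, edgeTail, origin]

theorem S1_eq : S.network.S1 = Set.range Edge.msg1 := by
  ext (e : S.Edge)
  change S.edgeHead e = Vert.source1 ↔ ∃ i, Edge.msg1 i = e
  rcases e with i | i | i | i | x | ⟨x, j, h⟩ | i | i <;> simp [edgeHead]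

theorem S2_eq : S.network.S2 = Set.range Edge.msg2 := by
  ext (e : S.Edge)
  change S.edgeHead e = Vert.source2 ↔ ∃ i, Edge.msg2 i = e
  rcases e with i | i | i | i | x | ⟨x, j, h⟩ | i | i <;> simp [edgeHead]

theorem T1_eq : S.network.T1 = Set.range Edge.put1 := by
  ext (e : S.Edge)
  change S.edgeTail e = Vert.dest1 ↔ ∃ i, Edge.put1 i = e
  rcases e with i | i | i | i | (x | x | x) | ⟨x, j, h⟩ | i | i <;> simp [edgeTail, origin]

theorem T2_eq : S.network.T2 = Set.range Edge.put2 := by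
  ext (e : S.Edge)
  change S.edgeTail e = Vert.dest2 ↔ ∃ i, Edge.put2 i = e
  rcases e with i | i | i | i | (x | x | x) | ⟨x, j, h⟩ | i | i <;> simp [edgeTail, origin]

theorem Out1_eq : S.network.Out1 = Set.range fun i => Edge.wire (Wire.u i) := by
  ext (e : S.Edge)
  change S.edgeTail e = Vert.source1 ↔ ∃ i, Edge.wire (Wire.u i) = e
  rcases e with i | i | i | i | (x | x | x) | ⟨x, j, h⟩ | i | i <;> simp [edgeTail, origin]

theorem Out2_eq : S.network.Out2 = Set.range fun i => Edge.wire (Wire.v i) := by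
  ext (e : S.Edge)
  change S.edgeTail e = Vert.source2 ↔ ∃ i, Edge.wire (Wire.v i) = e
  rcases e with i | i | i | i | (x | x | x) | ⟨x, j, h⟩ | i | i <;> simp [edgeTail, origin]

theorem ncard_range {α : Type*} {f : Fin k → α} (hf : f.Injective) :
    (Set.range f).ncard = k := by
  rw [← Set.image_univ, Set.ncard_image_of_injective _ hf, Set.ncard_univ, Nat.card_fin]

theorem ncard_S1 : S.network.S1.ncard = k := by
  rw [S1_eq]; exact ncard_range fun _ _ h => by injection h

theorem ncard_S2 : S.network.S2.ncard = k := by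
  rw [S2_eq]; exact ncard_range fun _ _ h => by injection h

theorem ncard_T1 : S.network.T1.ncard = k := by
  rw [T1_eq]; exact ncard_range fun _ _ h => by injection h

theorem ncard_T2 : S.network.T2.ncard = k := by
  rw [T2_eq]; exact ncard_range fun _ _ h => by injection h

theorem mem_relayEdge (e : S.Edge) : e ∈ S.network.RelayEdge ↔
    (∃ j, e = .wire (.inner j)) ∨ (∃ x j h, e = .copy x j h) ∨ (∃ i, e = .into1 i) ∨
      ∃ i, e = .into2 i := by
  rw [TwoUnicastZ.RelayEdge, S1_eq, S2_eq, T1_eq, T2_eq, Out1_eq, Out2_eq]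
  change ¬((((((∃ i, Edge.msg1 i = e) ∨ ∃ i, Edge.msg2 i = e) ∨ ∃ i, Edge.wire (.u i) = e) ∨
    ∃ i, Edge.wire (.v i) = e) ∨ ∃ i, Edge.put1 i = e) ∨ ∃ i, Edge.put2 i = e) ↔ _
  rcases e with i | i | i | i | (x | x | x) | ⟨x, j, h⟩ | i | i <;> simp
  exact h

theorem mem_In_inner (j : S.J) (e : S.Edge) :
    e ∈ S.network.In (Edge.wire (.inner j)) ↔ ∃ x h, e = .copy x j h := by
  change S.edgeHead e = .gather j ↔ _
  rcases e with i | i | i | i | x | ⟨x, j', h⟩ | i | i <;> simp [edgeHead]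
  rintro rfl
  exact h

theorem mem_In_copy (x : Wire k S.J) (j : S.J) (h : x ∈ S.dep j) (e : S.Edge) :
    e ∈ S.network.In (Edge.copy x j h) ↔ e = .wire x := by
  change S.edgeHead e = .hub x ↔ _
  rcases e with i | i | i | i | x | ⟨x, j', h⟩ | i | i <;> simp [edgeHead]

theorem mem_In_into1 (i : Fin k) (e : S.Edge) :
    e ∈ S.network.In (Edge.into1 i) ↔ e = .wire (S.out1 i) := by
  change S.edgeHead e = .hub (S.out1 i) ↔ _
  rcases e with i | i | i | i | x | ⟨x, j', h⟩ | i | i <;> simp [edgeHead]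

theorem mem_In_into2 (i : Fin k) (e : S.Edge) :
    e ∈ S.network.In (Edge.into2 i) ↔ e = .wire (S.out2 i) := by
  change S.edgeHead e = .hub (S.out2 i) ↔ _
  rcases e with i | i | i | i | x | ⟨x, j', h⟩ | i | i <;> simp [edgeHead]

theorem mem_In_put1 (i : Fin k) (e : S.Edge) :
    e ∈ S.network.In (Edge.put1 i) ↔ ∃ i', e = .into1 i' := by
  change S.edgeHead e = .dest1 ↔ _
  rcases e with i | i | i | i | x | ⟨x, j', h⟩ | i | i <;> simp [edgeHead]

theorem mem_In_put2 (i : Fin k) (e : S.Edge) :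
    e ∈ S.network.In (Edge.put2 i) ↔ ∃ i', e = .into2 i' := by
  change S.edgeHead e = .dest2 ↔ _
  rcases e with i | i | i | i | x | ⟨x, j', h⟩ | i | i <;> simp [edgeHead]

end WireSystem

/-! ### The bound on the rates by the output edges -/

namespace TwoUnicastZ

variable {N : TwoUnicastZ}

theorem rate_le_of_injective {A : Type*} [Finite A] {n : ℕ} (hn : 0 < n) {R : ℝ≥0}
    {f : Fin ⌈(n : ℝ≥0) * R⌉₊ → A × Fin n} (hf : f.Injective) : R ≤ Nat.card A := by
  have h1 := Nat.card_le_card_of_injective f hf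
  rw [Nat.card_fin, Nat.card_prod, Nat.card_fin, Nat.ceil_le] at h1
  have hn' : (0 : ℝ≥0) < n := by exact_mod_cast hn
  rw [Nat.cast_mul, mul_comm] at h1
  exact le_of_mul_le_mul_right h1 hn'

/-- No two symbols of a message can be read off at the same place, so no rate exceeds the number
of output edges of its destination. -/
theorem ZeroErrorAchievable.le_ncard {R1 R2 : ℝ≥0} (h : N.ZeroErrorAchievable R1 R2) :
    R1 ≤ N.T1.ncard ∧ R2 ≤ N.T2.ncard := by
  obtain ⟨A, _, _, n, hn, c, hc⟩ := h
  have := N.finite_E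
  classical
  obtain ⟨a, b, hab⟩ := exists_pair_ne A
  constructor
  · refine rate_le_of_injective hn (f := c.place1) fun p q hpq => ?_
    by_contra hne
    obtain ⟨x, -, hx, -⟩ := hc (fun l => if l = p then a else b) (fun _ => a)
    have hp := hx p
    have hq := hx q
    rw [hpq, hq, if_pos rfl, if_neg (Ne.symm hne)] at hp
    exact hab hp.symm
  · refine rate_le_of_injective hn (f := c.place2) fun p q hpq => ?_
    by_contra hne
    obtain ⟨x, -, -, hx⟩ := hc (fun _ => a) (fun l => if l = p then a else b)
    have hp := hx p
    have hq := hx q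
    rw [hpq, hq, if_pos rfl, if_neg (Ne.symm hne)] at hp
    exact hab hp.symm

/-- If every output edge is saturated, the rate pair is the capacity. -/
theorem ZeroErrorAchievable.isZeroErrorCapacity {R1 R2 : ℝ≥0} (h : N.ZeroErrorAchievable R1 R2)
    (h1 : R1 = N.T1.ncard) (h2 : R2 = N.T2.ncard) : N.IsZeroErrorCapacity (R1, R2) := by
  refine ⟨?_, fun B hB => hB (subset_closure h)⟩
  rw [zeroErrorRegion, upperBounds_closure]
  intro R hR
  rw [Prod.le_def, h1, h2]
  exact ZeroErrorAchievable.le_ncard hR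

end TwoUnicastZ

/-! ### Linear codes as linear rules for the signals -/

namespace TwoUnicastZ.Code

variable {N : TwoUnicastZ} {K : Type} [Field K] {n : ℕ} {R1 R2 : ℝ≥0}

open Classical in
/-- The relay function of an edge of a linear code as a linear map on the blocks of all edges (zero
unless the edge is a relay edge). -/
noncomputable def relayLin {c : N.Code K n R1 R2} (hl : c.IsLinear) (e : N.E) :
    (N.E → Fin n → K) →ₗ[K] (Fin n → K) :=
  if h : e ∈ N.RelayEdge then
    (hl.relay ⟨e, h⟩).mk' ∘ₗ LinearMap.funLeft K (Fin n → K) (Subtype.val : N.In e → N.E)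
  else 0

theorem relayLin_apply {c : N.Code K n R1 R2} (hl : c.IsLinear) {e : N.E} (h : e ∈ N.RelayEdge)
    (x : N.E → Fin n → K) : relayLin hl e x = c.relay ⟨e, h⟩ (fun e' => x e') := by
  rw [relayLin, dif_pos h]
  rfl

theorem relayLin_congr {c : N.Code K n R1 R2} (hl : c.IsLinear) {e : N.E}
    {x y : N.E → Fin n → K} (hxy : ∀ e' ∈ N.In e, x e' = y e') :
    relayLin hl e x = relayLin hl e y := by
  by_cases h : e ∈ N.RelayEdge
  · rw [relayLin_apply hl h, relayLin_apply hl h]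
    congr 1
    funext e'
    exact hxy e' e'.2
  · simp [relayLin, h]

end TwoUnicastZ.Code

namespace WireSystem

open TwoUnicastZ TwoUnicastZ.Code

variable {k : ℕ} (S : WireSystem k)

/-- `y` assigns values to the signals which obey the linear rules given by `M`. -/
def IsSolution {K V : Type} [Field K] [AddCommGroup V] [Module K V]
    (M : S.J → Wire k S.J → V →ₗ[K] V) (y : Wire k S.J → V) : Prop :=
  ∀ j, y (.inner j) = ∑ x ∈ S.dep j, M j x (y x)

variable {S} {K V : Type} [Field K] [AddCommGroup V] [Module K V]
  {M : S.J → Wire k S.J → V →ₗ[K] V}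

theorem IsSolution.add {y z : Wire k S.J → V} (hy : S.IsSolution M y) (hz : S.IsSolution M z) :
    S.IsSolution M (y + z) := fun j => by
  simp [hy j, hz j, Finset.sum_add_distrib]

theorem IsSolution.smul {y : Wire k S.J → V} (r : K) (hy : S.IsSolution M y) :
    S.IsSolution M (r • y) := fun j => by
  simp [hy j, Finset.smul_sum]

theorem IsSolution.sub {y z : Wire k S.J → V} (hy : S.IsSolution M y) (hz : S.IsSolution M z) :
    S.IsSolution M (y - z) := fun j => by
  simp [hy j, hz j]

theorem IsSolution.eq_zero {y : Wire k S.J → V} (hy : S.IsSolution M y)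
    (hu : ∀ i, y (.u i) = 0) (hv : ∀ i, y (.v i) = 0) (x : Wire k S.J) : y x = 0 := by
  have key : ∀ r j, S.rank j < r → y (.inner j) = 0 := by
    intro r
    induction r with
    | zero => intro j hj; omega
    | succ r ih =>
      intro j hj
      rw [hy j]
      refine Finset.sum_eq_zero fun x hx => ?_
      rcases x with i | i | j'
      · rw [hu, map_zero]
      · rw [hv, map_zero]
      · rw [ih j' (by have := S.rank_lt j j' hx; omega), map_zero]
  rcases x with i | i | j
  · exact hu i
  · exact hv i
  · exact key _ j (Nat.lt_succ_self _)

theorem IsSolution.ext {y z : Wire k S.J → V} (hy : S.IsSolution M y) (hz : S.IsSolution M z)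
    (hu : ∀ i, y (.u i) = z (.u i)) (hv : ∀ i, y (.v i) = z (.v i)) : y = z := by
  funext x
  exact sub_eq_zero.1 ((hy.sub hz).eq_zero (fun i => sub_eq_zero.2 (hu i))
    (fun i => sub_eq_zero.2 (hv i)) x)

/-- The signal which an edge carries or of which it carries a copy; the value is irrelevant for the
message edges and the output edges. -/
def carried : S.Edge → Wire k S.J
  | .msg1 i => .u i
  | .msg2 i => .u i
  | .put1 i => .u i
  | .put2 i => .u i
  | .wire x => x
  | .copy x _ _ => x
  | .into1 i => S.out1 i
  | .into2 i => S.out2 i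

section Extract

variable {n : ℕ} {R1 R2 : ℝ≥0} {c : S.network.Code K n R1 R2} (hl : c.IsLinear)

/-- The block of `wire (inner j)` as a linear function of the signals. -/
noncomputable def wireLin (j : S.J) : (Wire k S.J → Fin n → K) →ₗ[K] (Fin n → K) :=
  relayLin hl (Edge.wire (.inner j) : S.Edge) ∘ₗ
    LinearMap.pi fun e' : S.Edge => relayLin hl e' ∘ₗ
      LinearMap.pi fun _ => LinearMap.proj (carried e')

theorem wireLin_apply (j : S.J) (y : Wire k S.J → Fin n → K) :
    wireLin hl j y = relayLin hl (Edge.wire (.inner j) : S.Edge)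
      (fun e' : S.Edge => relayLin hl e' fun _ => y (carried e')) := rfl

theorem wireLin_single (j : S.J) (x : Wire k S.J) (hx : x ∉ S.dep j) (a : Fin n → K) :
    wireLin hl j (Pi.single x a) = 0 := by
  rw [wireLin_apply, ← map_zero (relayLin hl (Edge.wire (.inner j) : S.Edge))]
  refine relayLin_congr hl fun e' he' => ?_
  obtain ⟨x', h, rfl⟩ := (S.mem_In_inner j e').1 he'
  have : x' ≠ x := fun h' => hx (h' ▸ h)
  simp only [carried, Pi.single_eq_of_ne this]
  exact map_zero (relayLin hl _)

/-- The linear map with which the signal `x` enters the signal `inner j`. -/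
noncomputable def coeffLin (j : S.J) (x : Wire k S.J) : (Fin n → K) →ₗ[K] (Fin n → K) :=
  wireLin hl j ∘ₗ LinearMap.single K (fun _ => Fin n → K) x

theorem wireLin_eq_sum (j : S.J) (y : Wire k S.J → Fin n → K) :
    wireLin hl j y = ∑ x ∈ S.dep j, coeffLin hl j x (y x) := by
  have h1 : y = ∑ x, Pi.single x (y x) := (Finset.univ_sum_single y).symm
  conv_lhs => rw [h1, map_sum]
  symm
  exact Finset.sum_subset (Finset.subset_univ _) fun x _ hx => wireLin_single hl j x hx _

variable {w1 : Msg K n R1} {w2 : Msg K n R2} {x : S.network.E → Fin n → K}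

theorem isRun_isSolution (hx : c.IsRun w1 w2 x) :
    S.IsSolution (coeffLin hl) fun s => x (Edge.wire s : S.Edge) := by
  intro j
  have hj : (Edge.wire (.inner j) : S.Edge) ∈ S.network.RelayEdge :=
    (S.mem_relayEdge _).2 (.inl ⟨j, rfl⟩)
  rw [← wireLin_eq_sum hl j fun s => x (Edge.wire s : S.Edge), wireLin_apply]
  refine (hx.relay ⟨_, hj⟩).trans ?_
  rw [← relayLin_apply hl hj]
  refine relayLin_congr hl fun e' he' => ?_
  obtain ⟨s, h, rfl⟩ := (S.mem_In_inner j e').1 he'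
  have hs : (Edge.copy s j h : S.Edge) ∈ S.network.RelayEdge :=
    (S.mem_relayEdge _).2 (.inr (.inl ⟨s, j, h, rfl⟩))
  refine (hx.relay ⟨_, hs⟩).trans ?_
  rw [← relayLin_apply hl hs]
  refine relayLin_congr hl fun e'' he'' => ?_
  rw [(S.mem_In_copy s j h e'').1 he'']
  rfl

theorem isRun_into1 (hx : c.IsRun w1 w2 x) (i : Fin k) :
    x (Edge.into1 i : S.Edge) =
      relayLin hl (Edge.into1 i : S.Edge) fun _ => x (Edge.wire (S.out1 i) : S.Edge) := by
  have hs : (Edge.into1 i : S.Edge) ∈ S.network.RelayEdge :=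
    (S.mem_relayEdge _).2 (.inr (.inr (.inl ⟨i, rfl⟩)))
  refine (hx.relay ⟨_, hs⟩).trans ?_
  rw [← relayLin_apply hl hs]
  refine relayLin_congr hl fun e'' he'' => ?_
  rw [(S.mem_In_into1 i e'').1 he'']

theorem isRun_into2 (hx : c.IsRun w1 w2 x) (i : Fin k) :
    x (Edge.into2 i : S.Edge) =
      relayLin hl (Edge.into2 i : S.Edge) fun _ => x (Edge.wire (S.out2 i) : S.Edge) := by
  have hs : (Edge.into2 i : S.Edge) ∈ S.network.RelayEdge :=
    (S.mem_relayEdge _).2 (.inr (.inr (.inr ⟨i, rfl⟩)))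
  refine (hx.relay ⟨_, hs⟩).trans ?_
  rw [← relayLin_apply hl hs]
  refine relayLin_congr hl fun e'' he'' => ?_
  rw [(S.mem_In_into2 i e'').1 he'']

/-- If destination 1 receives only zeros, it puts out only zeros. -/
theorem isRun_eq_zero1 (hl : c.IsLinear) (hx : c.IsRun w1 w2 x)
    (h : ∀ i, x (Edge.wire (S.out1 i) : S.Edge) = 0) (t : S.network.T1) : x t = 0 := by
  rw [hx.dec1 t, ← (hl.dec1 t).map_zero]
  congr 1
  funext e'
  obtain ⟨e, he⟩ := e'
  obtain ⟨t, ht⟩ := t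
  rw [S.T1_eq] at ht
  obtain ⟨i, rfl⟩ := ht
  obtain ⟨i', rfl⟩ := (S.mem_In_put1 i e).1 he
  refine (isRun_into1 hl hx i').trans ?_
  rw [h]
  exact map_zero (relayLin hl _)

/-- If destination 2 receives only zeros and the first message is zero, it puts out only zeros. -/
theorem isRun_eq_zero2 (hl : c.IsLinear) (hx : c.IsRun 0 w2 x)
    (h : ∀ i, x (Edge.wire (S.out2 i) : S.Edge) = 0) (t : S.network.T2) : x t = 0 := by
  rw [hx.dec2 t, ← (hl.dec2 t).map_zero]
  congr 1
  refine Prod.ext ?_ rfl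
  funext e'
  obtain ⟨e, he⟩ := e'
  obtain ⟨t, ht⟩ := t
  rw [S.T2_eq] at ht
  obtain ⟨i, rfl⟩ := ht
  obtain ⟨i', rfl⟩ := (S.mem_In_put2 i e).1 he
  refine (isRun_into2 hl hx i').trans ?_
  rw [h]
  exact map_zero (relayLin hl _)

end Extract

theorem finrank_msg (n k : ℕ) :
    Module.finrank K (Msg K n (k : ℝ≥0)) = Module.finrank K (Fin k → Fin n → K) := by
  rw [Module.finrank_fintype_fun_eq_card, Module.finrank_pi_fintype, Fintype.card_fin,
    ← Nat.cast_mul, Nat.ceil_natCast]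
  simp [mul_comm]

/-- Solutions of the linear rules are parametrized by the signals of the two sources, as soon as
all values of these are taken. -/
theorem exists_solution_map
    (hM : ∀ a b : Fin k → V, ∃ y, S.IsSolution M y ∧ (∀ i, y (.u i) = a i) ∧
      ∀ i, y (.v i) = b i) :
    ∃ Y : ((Fin k → V) × (Fin k → V)) →ₗ[K] (Wire k S.J → V),
      ∀ a b, S.IsSolution M (Y (a, b)) ∧ (∀ i, Y (a, b) (.u i) = a i) ∧
        ∀ i, Y (a, b) (.v i) = b i := by
  choose y hy hu hv using hM
  refine ⟨{ toFun := fun p => y p.1 p.2, map_add' := fun p q => ?_, map_smul' := fun r p => ?_ },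
    fun a b => ⟨hy a b, hu a b, hv a b⟩⟩
  · refine (hy _ _).ext ((hy _ _).add (hy _ _)) ?_ ?_ <;> simp [hu, hv]
  · refine (hy _ _).ext ((hy _ _).smul r) ?_ ?_ <;> simp [hu, hv]

/-- A linear code which attains the full rate amounts to linear rules whose solutions are such that
the signals received by destination 1 are in bijection with those emitted by source 1, whatever
source 2 emits, and destination 2 can tell apart the signals emitted by source 2. -/
theorem exists_linear_rules (h : S.network.LinearlyZeroErrorAchievable k k) :
    ∃ (K : Type) (_ : Field K) (n : ℕ) (_ : 0 < n)
      (M : S.J → Wire k S.J → (Fin n → K) →ₗ[K] (Fin n → K))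
      (Y : ((Fin k → Fin n → K) × (Fin k → Fin n → K)) →ₗ[K] (Wire k S.J → Fin n → K)),
      (∀ a b, S.IsSolution M (Y (a, b)) ∧ (∀ i, Y (a, b) (.u i) = a i) ∧
        ∀ i, Y (a, b) (.v i) = b i) ∧
      (∀ a b, (∀ i, Y (a, b) (S.out1 i) = 0) ↔ a = 0) ∧
      ∀ b, (∀ i, Y (0, b) (S.out2 i) = 0) → b = 0 := by
  obtain ⟨K, _, n, hn, c, hl, hc⟩ := h
  have hOut1 (i : Fin k) : (Edge.wire (.u i) : S.Edge) ∈ S.network.Out1 := by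
    rw [Out1_eq]; exact ⟨i, rfl⟩
  have hOut2 (i : Fin k) : (Edge.wire (.v i) : S.Edge) ∈ S.network.Out2 := by
    rw [Out2_eq]; exact ⟨i, rfl⟩
  let U : Msg K n (k : ℝ≥0) →ₗ[K] (Fin k → Fin n → K) :=
    LinearMap.pi fun i => (hl.enc1 ⟨_, hOut1 i⟩).mk'
  let W : Msg K n (k : ℝ≥0) →ₗ[K] (Fin k → Fin n → K) :=
    LinearMap.pi fun i => (hl.enc2 ⟨_, hOut2 i⟩).mk'
  choose x hx hd1 hd2 using hc
  have hxU (w1 w2 i) : x w1 w2 (Edge.wire (.u i) : S.Edge) = U w1 i :=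
    (hx w1 w2).enc1 ⟨_, hOut1 i⟩
  have hxW (w1 w2 i) : x w1 w2 (Edge.wire (.v i) : S.Edge) = W w2 i :=
    (hx w1 w2).enc2 ⟨_, hOut2 i⟩
  have hsol (w1 w2) := isRun_isSolution hl (hx w1 w2)
  have dec1 (w1 w2) (h : ∀ i, x w1 w2 (Edge.wire (S.out1 i) : S.Edge) = 0) : w1 = 0 := by
    funext κ
    rw [← hd1 w1 w2 κ, isRun_eq_zero1 hl (hx w1 w2) h]
    rfl
  have dec2 (w2) (h : ∀ i, x 0 w2 (Edge.wire (S.out2 i) : S.Edge) = 0) : w2 = 0 := by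
    funext κ
    rw [← hd2 0 w2 κ, isRun_eq_zero2 hl (hx 0 w2) h]
    rfl
  have hU : Function.Injective U := by
    refine (injective_iff_map_eq_zero U).2 fun w1 h => dec1 w1 0 fun i => ?_
    exact (hsol w1 0).eq_zero (fun i => by rw [hxU, h]; rfl)
      (fun i => by rw [hxW, map_zero]; rfl) _
  have hW : Function.Injective W := by
    refine (injective_iff_map_eq_zero W).2 fun w2 h => dec2 w2 fun i => ?_
    exact (hsol 0 w2).eq_zero (fun i => by rw [hxU, map_zero]; rfl)
      (fun i => by rw [hxW, h]; rfl) _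
  have hU' := (LinearMap.injective_iff_surjective_of_finrank_eq_finrank (finrank_msg n k)).1 hU
  have hW' := (LinearMap.injective_iff_surjective_of_finrank_eq_finrank (finrank_msg n k)).1 hW
  obtain ⟨Y, hY⟩ := exists_solution_map (S := S) (M := coeffLin hl) fun a b => by
    obtain ⟨w1, rfl⟩ := hU' a
    obtain ⟨w2, rfl⟩ := hW' b
    exact ⟨_, hsol w1 w2, hxU w1 w2, hxW w1 w2⟩
  have hxY (w1 w2) : (fun s => x w1 w2 (Edge.wire s : S.Edge)) = Y (U w1, W w2) :=
    (hsol w1 w2).ext (hY _ _).1 (fun i => by rw [hxU, (hY _ _).2.1])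
      fun i => by rw [hxW, (hY _ _).2.2]
  have inj1 (a b) (h : ∀ i, Y (a, b) (S.out1 i) = 0) : a = 0 := by
    obtain ⟨w1, rfl⟩ := hU' a
    obtain ⟨w2, rfl⟩ := hW' b
    rw [dec1 w1 w2 fun i => (congrFun (hxY w1 w2) _).trans (h i), map_zero]
  refine ⟨K, _, n, hn, coeffLin hl, Y, hY, fun a b => ⟨inj1 a b, ?_⟩, fun b h => ?_⟩
  · rintro rfl
    -- The signals received at destination 1 when source 2 is silent already take all values, in
    -- particular those received when source 2 emits `b`.
    let T : (Fin k → Fin n → K) →ₗ[K] (Fin k → Fin n → K) :=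
      LinearMap.pi fun i => LinearMap.proj (S.out1 i) ∘ₗ Y ∘ₗ LinearMap.inl K _ _
    have hT : Function.Injective T :=
      (injective_iff_map_eq_zero T).2 fun a h => inj1 a 0 fun i => congrFun h i
    obtain ⟨a, ha⟩ := LinearMap.injective_iff_surjective.1 hT fun i => Y (0, b) (S.out1 i)
    have hab (i) : Y (a, 0) (S.out1 i) = Y (0, b) (S.out1 i) := congrFun ha i
    have h0 := inj1 (a - 0) (0 - b) fun i => by
      rw [← Prod.mk_sub_mk, map_sub, Pi.sub_apply, hab, sub_self]
    rw [sub_zero] at h0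
    intro i
    rw [← hab, h0, ← Prod.zero_eq_mk, map_zero]
    rfl
  · obtain ⟨w2, rfl⟩ := hW' b
    have := hxY 0 w2
    rw [map_zero] at this
    rw [dec2 w2 fun i => (congrFun this _).trans (h i), map_zero]

end WireSystem

/-! ### Linear algebra of the Fano and non-Fano networks -/

section LinearAlgebra

variable {K V : Type*} [Field K] [AddCommGroup V] [Module K V] [FiniteDimensional K V]

/-- If an injective linear map is lower triangular, its diagonal is injective. -/
theorem LinearMap.eq_zero_of_lowerTriangular {k : ℕ} (T : (Fin k → V) →ₗ[K] (Fin k → V))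
    (hT : Function.Injective T) (hlow : ∀ a i, (∀ j ≤ i, a j = 0) → T a i = 0)
    (i : Fin k) (a : Fin k → V) (ha : ∀ j < i, a j = 0) (hi : T a i = 0) : a i = 0 := by
  let P : Submodule K (Fin k → V) :=
    { carrier := {a | ∀ j ≤ i, a j = 0}
      add_mem' := fun {a b} ha hb j hj => by simp [ha j hj, hb j hj]
      zero_mem' := fun _ _ => rfl
      smul_mem' := fun r a ha j hj => by simp [ha j hj] }
  have hP (a) (ha : a ∈ P) : T a ∈ P :=
    fun j hj => hlow a j fun l hl => ha l (hl.trans hj)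
  have hinj : Function.Injective (T.restrict hP) := fun a b hab =>
    Subtype.ext (hT (congrArg Subtype.val hab))
  have hTa : T a ∈ P := by
    intro j hj
    rcases hj.lt_or_eq with hj | rfl
    · exact hlow a j fun l hl => ha l (hl.trans_lt hj)
    · exact hi
  obtain ⟨⟨b, hb⟩, hb'⟩ := LinearMap.injective_iff_surjective.1 hinj ⟨_, hTa⟩
  rw [← hT (congrArg Subtype.val hb' : T b = T a)]
  exact hb i le_rfl

theorem LinearMap.surjective_of_ker {f : V →ₗ[K] V} (h : ∀ a, f a = 0 → a = 0) :
    Function.Surjective f :=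
  LinearMap.injective_iff_surjective.1 ((injective_iff_map_eq_zero f).2 h)

/-- The linear form of the Fano network, in which `w = W₁ a + W₂ b`, `y = Y₂ b + Y₃ c`,
`x = X₁ w + X₃ c`, `z = Z₁ w + Z₂ y`: if `a`, `b`, `c` can be decoded from `(x, y)`, `(x, z)`,
`(a, z)` respectively, the characteristic is two. -/
theorem add_self_eq_zero_of_fano (W₁ W₂ X₁ X₃ Y₂ Y₃ Z₁ Z₂ : V →ₗ[K] V)
    (ha : ∀ a b c, X₁ (W₁ a + W₂ b) + X₃ c = 0 → Y₂ b + Y₃ c = 0 → a = 0)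
    (hb : ∀ a b c, X₁ (W₁ a + W₂ b) + X₃ c = 0 → Z₁ (W₁ a + W₂ b) + Z₂ (Y₂ b + Y₃ c) = 0 → b = 0)
    (hc : ∀ b c, Z₁ (W₂ b) + Z₂ (Y₂ b + Y₃ c) = 0 → c = 0) (t : V) : t + t = 0 := by
  have hZY : Function.Surjective (Z₂ ∘ₗ Y₃) := LinearMap.surjective_of_ker fun c h =>
    hc 0 c (by simpa using h)
  have hY : Function.Surjective Y₃ := LinearMap.surjective_of_ker fun c h =>
    hc 0 c (by simp [h])
  have hXW1 (a) (h : X₁ (W₁ a) = 0) : a = 0 := ha a 0 0 (by simpa using h) (by simp)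
  have hW1 : Function.Surjective W₁ := LinearMap.surjective_of_ker fun a h =>
    hXW1 a (by simp [h])
  have hXW : Function.Surjective (X₁ ∘ₗ W₁) := LinearMap.surjective_of_ker hXW1
  -- When `a = 0`, the signal `z` determines `c`; it can then not depend on `b`.
  have hz (b) : Z₁ (W₂ b) + Z₂ (Y₂ b) = 0 := by
    obtain ⟨c, h⟩ := hZY (-(Z₁ (W₂ b) + Z₂ (Y₂ b)))
    rw [LinearMap.comp_apply] at h
    have h0 : c = 0 := hc b c (by rw [map_add, h]; abel)
    rw [h0, map_zero, map_zero] at h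
    exact neg_eq_zero.1 h.symm
  have hXW2 (b) (h : X₁ (W₂ b) = 0) : b = 0 := by
    refine hb 0 b 0 (by simpa using h) ?_
    simpa using hz b
  have hXW2' : Function.Surjective (X₁ ∘ₗ W₂) := LinearMap.surjective_of_ker hXW2
  have h1 (a c) (h : Z₁ (W₁ a) + Z₂ (Y₃ c) = 0) : X₁ (W₁ a) + X₃ c = 0 := by
    obtain ⟨b, hb'⟩ := hXW2' (-(X₁ (W₁ a) + X₃ c))
    rw [LinearMap.comp_apply] at hb'
    have h0 : b = 0 := by
      refine hb a b c (by rw [map_add, hb']; abel) ?_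
      have := hz b
      rw [map_add, map_add]
      calc _ = (Z₁ (W₁ a) + Z₂ (Y₃ c)) + (Z₁ (W₂ b) + Z₂ (Y₂ b)) := by abel
        _ = 0 := by rw [h, this, add_zero]
    rw [h0, map_zero, map_zero] at hb'
    exact neg_eq_zero.1 hb'.symm
  have h2 (b c) (h : Y₂ b + Y₃ c = 0) : X₁ (W₂ b) + X₃ c = 0 := by
    obtain ⟨a, ha'⟩ := hXW (-(X₁ (W₂ b) + X₃ c))
    rw [LinearMap.comp_apply] at ha'
    have h0 : a = 0 := ha a b c (by rw [map_add, ha']; abel) h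
    rw [h0, map_zero, map_zero] at ha'
    exact neg_eq_zero.1 ha'.symm
  -- The messages `(0, t, c)` make `y` vanish and `(a, 0, c)` make `z` vanish; comparing the two
  -- relations so obtained gives `X₃ c` in terms of `t` with both signs.
  obtain ⟨c, hc'⟩ := hY (-Y₂ t)
  obtain ⟨a, ha'⟩ := hW1 (-W₂ t)
  have e1 : X₁ (W₂ t) + X₃ c = 0 := h2 t c (by rw [hc']; abel)
  have e2 : X₁ (W₁ a) + X₃ c = 0 := h1 a c (by
    rw [hc', ha', map_neg, map_neg, ← neg_add, hz, neg_zero])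
  rw [ha', map_neg] at e2
  refine hXW2 _ ?_
  rw [map_add, map_add]
  calc _ = (X₁ (W₂ t) + X₃ c) - (-X₁ (W₂ t) + X₃ c) := by abel
    _ = 0 := by rw [e1, e2, sub_zero]

/-- If `c` can be decoded from `A a + B b + C c` and `X₁ a + X₂ b`, the second of these
is a function of `A a + B b`. -/
theorem LinearMap.add_eq_zero_of_decodable {A B C X₁ X₂ : V →ₗ[K] V} (hA : ∀ a, A a = 0 → a = 0)
    (hC : Function.Surjective C)
    (h : ∀ a b c, A a + B b + C c = 0 → X₁ a + X₂ b = 0 → c = 0) {a b : V}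
    (hab : A a + B b = 0) : X₁ a + X₂ b = 0 := by
  have key (a b) (hx : X₁ a + X₂ b = 0) : A a + B b = 0 := by
    obtain ⟨c, hc⟩ := hC (-(A a + B b))
    have h0 : c = 0 := h a b c (by rw [hc]; abel) hx
    rw [h0, map_zero] at hc
    exact neg_eq_zero.1 hc.symm
  have hX : Function.Surjective X₁ := LinearMap.surjective_of_ker fun a ha =>
    hA a (by simpa using key a 0 (by simpa using ha))
  obtain ⟨a', ha'⟩ := hX (-X₂ b)
  have h1 := key a' b (by rw [ha']; abel)
  have h2 : a = a' := by
    refine sub_eq_zero.1 (hA _ ?_)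
    rw [map_sub, sub_eq_zero]
    exact add_right_cancel (hab.trans h1.symm)
  rw [h2, ha']
  abel

/-- The linear form of the non-Fano network, in which `w = A a + B b + C c`, `x = X₁ a + X₂ b`,
`y = Y₁ a + Y₃ c`, `z = Z₂ b + Z₃ c`, while `c`, `b`, `a` can be decoded from `w` together with
`x`, `y`, `z` respectively. In characteristic two, `(x, y, z)` contains no information on `c`. -/
theorem exists_eq_zero_of_nonFano {A B C X₁ X₂ Y₁ Y₃ Z₂ Z₃ : V →ₗ[K] V}
    (hc : ∀ a b c, A a + B b + C c = 0 → X₁ a + X₂ b = 0 → c = 0)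
    (hb : ∀ a b c, A a + B b + C c = 0 → Y₁ a + Y₃ c = 0 → b = 0)
    (ha : ∀ a b c, A a + B b + C c = 0 → Z₂ b + Z₃ c = 0 → a = 0)
    (h2 : ∀ t : V, t + t = 0) (c : V) :
    ∃ a b, X₁ a + X₂ b = 0 ∧ Y₁ a + Y₃ c = 0 ∧ Z₂ b + Z₃ c = 0 := by
  have hA (a) (h : A a = 0) : a = 0 := ha a 0 0 (by simp [h]) (by simp)
  have hB (b) (h : B b = 0) : b = 0 := hb 0 b 0 (by simp [h]) (by simp)
  have hC (c) (h : C c = 0) : c = 0 := hc 0 0 c (by simp [h]) (by simp)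
  obtain ⟨a, ha'⟩ := LinearMap.surjective_of_ker hA (C c)
  obtain ⟨b, hb'⟩ := LinearMap.surjective_of_ker hB (C c)
  refine ⟨a, b, ?_, ?_, ?_⟩
  · refine LinearMap.add_eq_zero_of_decodable hA (LinearMap.surjective_of_ker hC) hc ?_
    rw [ha', hb', h2]
  · refine LinearMap.add_eq_zero_of_decodable (B := C) hA (LinearMap.surjective_of_ker hB)
      (fun a c b h h' => hb a b c ?_ h') ?_
    · rw [← h]; abel
    · rw [ha', h2]
  · refine LinearMap.add_eq_zero_of_decodable (B := C) hB (LinearMap.surjective_of_ker hA)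
      (fun b c a h h' => ha a b c ?_ h') ?_
    · rw [← h]; abel
    · rw [hb', h2]

end LinearAlgebra

/-! ### The network -/

/-- The signals computed in the network. The `m i` mask a signal by a signal of source 1, and the
`r i` are what destination 1 receives. The signals `fw`, `fx`, `fy`, `fz` form the Fano network,
and, for `s = 0, 1`, the signals `w s`, `x s`, `y s`, `z s` form a copy of the non-Fano network. -/
inductive Signal where
  | m (i : Fin 10)
  | r (i : Fin 10)
  | fw
  | fx
  | fy
  | fz
  | w (s : Fin 2)
  | x (s : Fin 2)
  | y (s : Fin 2)
  | z (s : Fin 2)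
  deriving DecidableEq, Fintype

namespace Signal

open Wire

/-- The first private message of the copy `s` of the non-Fano network. -/
def msgA (s : Fin 2) : Fin 10 := ![3, 5] s

/-- The second private message of the copy `s` of the non-Fano network. -/
def msgB (s : Fin 2) : Fin 10 := ![4, 6] s

/-- The signal masked in `m i`. The message 7, which is to be decoded at three places, is masked
three times in a row. -/
def prev : Fin 10 → Wire 10 Signal
  | 8 => inner (m 7)
  | 9 => inner (m 8)
  | i => v i

/-- The signals from which the message `target i` has to be decoded for `r i`. -/
def obs : Fin 10 → Finset (Wire 10 Signal)
  | 0 => {inner fx, inner fy}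
  | 1 => {inner fx, inner fz}
  | 2 => {v 0, inner fz}
  | 3 => {inner (w 0), inner (z 0)}
  | 4 => {inner (w 0), inner (y 0)}
  | 5 => {inner (w 1), inner (z 1)}
  | 6 => {inner (w 1), inner (y 1)}
  | 7 => {inner (w 0), inner (x 0)}
  | 8 => {inner (w 1), inner (x 1)}
  | 9 => {inner (x 0), inner (y 0), inner (z 0), inner (x 1), inner (y 1), inner (z 1)}

/-- The message to be decoded for `r i`. -/
def target (i : Fin 10) : Fin 10 := min i 7

/-- The signals of source 1 which mask the message 7 before it reaches `m i`. -/
def side : Fin 10 → Finset (Wire 10 Signal)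
  | 8 => {u 7}
  | 9 => {u 7, u 8}
  | _ => ∅

/-- The signals from which a signal is computed. The Fano network has the messages 0, 1, 2. -/
def dep : Signal → Finset (Wire 10 Signal)
  | m i => {u i, prev i}
  | r i => insert (inner (m i)) (obs i ∪ side i)
  | fw => {v 0, v 1}
  | fx => {inner fw, v 2}
  | fy => {v 1, v 2}
  | fz => {inner fw, inner fy}
  | w s => {v (msgA s), v (msgB s), v 7}
  | x s => {v (msgA s), v (msgB s)}
  | y s => {v (msgA s), v 7}
  | z s => {v (msgB s), v 7}

/-- A rank which increases along dependencies. -/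
def rank : Signal → ℕ
  | m i => i
  | r _ => 10
  | fx => 1
  | fz => 1
  | _ => 0

/-- The signals received by destination 2: the masked messages, of which the message 7 only
in its last form, and the messages 8 and 9, which are used nowhere else. -/
def toDest2 : Fin 10 → Wire 10 Signal
  | 7 => inner (m 9)
  | 8 => v 8
  | 9 => v 9
  | i => inner (m i)

end Signal

/-- The wire system of the network which separates linear from non-linear codes. It is reducible so
that its signals are recognized as `Signal`. -/
abbrev fanoNonFano : WireSystem 10 where
  J := Signal
  dep := Signal.dep
  rank := Signal.rank
  rank_lt := by decide
  out1 i := .inner (.r i)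
  out2 := Signal.toDest2

/-! ### No linear code -/

namespace Signal

open Wire

section Solution

variable {K V : Type} [Field K] [AddCommGroup V] [Module K V]
  {M : Signal → Wire 10 Signal → V →ₗ[K] V} {y : Wire 10 Signal → V}

theorem solution_pair (hy : fanoNonFano.IsSolution M y) {j : Signal} {p q : Wire 10 Signal}
    (hj : dep j = {p, q}) (hpq : p ≠ q) : y (inner j) = M j p (y p) + M j q (y q) := by
  refine (hy j).trans ?_
  change ∑ x ∈ dep j, M j x (y x) = _
  rw [hj, Finset.sum_pair hpq]

theorem solution_m (hy : fanoNonFano.IsSolution M y) (i : Fin 10) :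
    y (inner (m i)) = M (m i) (u i) (y (u i)) + M (m i) (prev i) (y (prev i)) :=
  solution_pair hy rfl (by revert i; decide)

theorem solution_r (hy : fanoNonFano.IsSolution M y) (i : Fin 10) :
    y (inner (r i)) = M (r i) (inner (m i)) (y (inner (m i))) +
      ∑ x ∈ obs i ∪ side i, M (r i) x (y x) := by
  refine (hy (r i)).trans ?_
  change ∑ x ∈ insert (inner (m i)) (obs i ∪ side i), M (r i) x (y x) = _
  rw [Finset.sum_insert (by revert i; decide)]

theorem solution_fw (hy : fanoNonFano.IsSolution M y) :
    y (inner fw) = M fw (v 0) (y (v 0)) + M fw (v 1) (y (v 1)) :=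
  solution_pair hy rfl (by decide)

theorem solution_fx (hy : fanoNonFano.IsSolution M y) :
    y (inner fx) = M fx (inner fw) (y (inner fw)) + M fx (v 2) (y (v 2)) :=
  solution_pair hy rfl (by decide)

theorem solution_fy (hy : fanoNonFano.IsSolution M y) :
    y (inner fy) = M fy (v 1) (y (v 1)) + M fy (v 2) (y (v 2)) :=
  solution_pair hy rfl (by decide)

theorem solution_fz (hy : fanoNonFano.IsSolution M y) :
    y (inner fz) = M fz (inner fw) (y (inner fw)) + M fz (inner fy) (y (inner fy)) :=
  solution_pair hy rfl (by decide)

theorem solution_x (hy : fanoNonFano.IsSolution M y) (s : Fin 2) :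
    y (inner (x s)) =
      M (x s) (v (msgA s)) (y (v (msgA s))) + M (x s) (v (msgB s)) (y (v (msgB s))) :=
  solution_pair hy rfl (by revert s; decide)

theorem solution_y (hy : fanoNonFano.IsSolution M y) (s : Fin 2) :
    y (inner (Signal.y s)) =
      M (Signal.y s) (v (msgA s)) (y (v (msgA s))) + M (Signal.y s) (v 7) (y (v 7)) :=
  solution_pair hy rfl (by revert s; decide)

theorem solution_z (hy : fanoNonFano.IsSolution M y) (s : Fin 2) :
    y (inner (z s)) =
      M (z s) (v (msgB s)) (y (v (msgB s))) + M (z s) (v 7) (y (v 7)) :=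
  solution_pair hy rfl (by revert s; decide)

theorem solution_w (hy : fanoNonFano.IsSolution M y) (s : Fin 2) :
    y (inner (w s)) = M (w s) (v (msgA s)) (y (v (msgA s))) +
      M (w s) (v (msgB s)) (y (v (msgB s))) + M (w s) (v 7) (y (v 7)) := by
  refine (hy (w s)).trans ?_
  change ∑ x ∈ {v (msgA s), v (msgB s), v 7}, M (w s) x (y x) = _
  rw [Finset.sum_insert (by revert s; decide), Finset.sum_pair (by revert s; decide), add_assoc]

theorem obs_eq_zero (hy : fanoNonFano.IsSolution M y) (hv : ∀ i, y (v i) = 0) (i : Fin 10)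
    (p : Wire 10 Signal) (hp : p ∈ obs i) : y p = 0 := by
  have hw : y (inner fw) = 0 := by simp [solution_fw hy, hv]
  have hfy : y (inner fy) = 0 := by simp [solution_fy hy, hv]
  rcases p with j | j | j
  · exact absurd hp (by revert i j; decide)
  · exact hv j
  · cases j with
    | m l => exact absurd hp (by revert i l; decide)
    | r l => exact absurd hp (by revert i l; decide)
    | fw => exact hw
    | fx => simp [solution_fx hy, hv, hw]
    | fy => exact hfy
    | fz => simp [solution_fz hy, hw, hfy]
    | w s => simp [solution_w hy, hv]
    | x s => simp [solution_x hy, hv]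
    | y s => simp [solution_y hy, hv]
    | z s => simp [solution_z hy, hv]

/-- The signal masked in `m i` is a function of the message `target i` and of the masks of
smaller index. -/
theorem prev_eq_zero (hy : fanoNonFano.IsSolution M y) (i : Fin 10)
    (hu : ∀ j < i, y (u j) = 0) (hv : y (v (target i)) = 0) : y (prev i) = 0 := by
  induction i using WellFoundedLT.induction with
  | ind i ih =>
    have key : prev i = v (target i) ∨
        ∃ j < i, prev i = inner (m j) ∧ target j = target i := by
      clear hu hv ih; revert i; decide
    obtain h | ⟨j, hj, h, ht⟩ := key
    · rw [h, hv]
    · rw [h, solution_m hy, hu j hj, ih j hj (fun l hl => hu l (hl.trans hj)) (ht ▸ hv)]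
      simp

theorem m_eq_zero (hy : fanoNonFano.IsSolution M y) (i : Fin 10)
    (hu : ∀ j ≤ i, y (u j) = 0) (hv : y (v (target i)) = 0) : y (inner (m i)) = 0 := by
  rw [solution_m hy, hu i le_rfl, prev_eq_zero hy i (fun j hj => hu j hj.le) hv]
  simp

theorem side_eq_zero (i : Fin 10) (hu : ∀ j < i, y (u j) = 0) (p : Wire 10 Signal)
    (hp : p ∈ side i) : y p = 0 := by
  have key : ∀ i, ∀ p ∈ side i, ∃ j < i, p = u j := by decide
  obtain ⟨j, hj, rfl⟩ := key i p hp
  exact hu j hj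

theorem solution_r_of_eq_zero (hy : fanoNonFano.IsSolution M y) (i : Fin 10)
    (hobs : ∀ p ∈ obs i, y p = 0) (hu : ∀ j < i, y (u j) = 0) :
    y (inner (r i)) = M (r i) (inner (m i)) (y (inner (m i))) := by
  rw [solution_r hy, Finset.sum_eq_zero, add_zero]
  intro p hp
  rcases Finset.mem_union.1 hp with hp | hp
  · rw [hobs p hp, map_zero]
  · rw [side_eq_zero i hu p hp, map_zero]

variable {Y : ((Fin 10 → V) × (Fin 10 → V)) →ₗ[K] (Wire 10 Signal → V)}

/-- The key property of the masks: since destination 1 learns the signals of source 1 whatever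
source 2 emits, and since destination 2 learns the signals of source 2, the message `target i`
can be decoded from the signals in `obs i`. -/
theorem decodable_of_obs [FiniteDimensional K V]
    (hY : ∀ a b, fanoNonFano.IsSolution M (Y (a, b)) ∧ (∀ i, Y (a, b) (u i) = a i) ∧
      ∀ i, Y (a, b) (v i) = b i)
    (h1 : ∀ a b, (∀ i, Y (a, b) (inner (r i)) = 0) ↔ a = 0)
    (h2 : ∀ b, (∀ i, Y (0, b) (toDest2 i) = 0) → b = 0)
    (i : Fin 10) (b : Fin 10 → V) (hobs : ∀ p ∈ obs i, Y (0, b) p = 0) :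
    b (target i) = 0 := by
  have hu0 (b i) : Y (0, b) (u i) = 0 := (hY 0 b).2.1 i
  have hv0 (a i) : Y (a, 0) (v i) = 0 := (hY a 0).2.2 i
  let T : (Fin 10 → V) →ₗ[K] (Fin 10 → V) :=
    LinearMap.pi fun i => LinearMap.proj (inner (r i)) ∘ₗ Y ∘ₗ LinearMap.inl K _ _
  have hTapp (a i) : T a i = Y (a, 0) (inner (r i)) := rfl
  have hT : Function.Injective T :=
    (injective_iff_map_eq_zero T).2 fun a h => (h1 a 0).1 fun i => congrFun h i
  -- While source 2 is silent, destination 1 receives a lower triangular function `T` of the masks,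
  -- with the composites of the maps into `r i` and into `m i` on the diagonal.
  have hTr (a i) (ha : ∀ j < i, a j = 0) :
      T a i = M (r i) (inner (m i)) (M (m i) (u i) (a i)) := by
    have hu' : ∀ j < i, Y (a, 0) (u j) = 0 := fun j hj => by rw [(hY a 0).2.1, ha j hj]
    rw [hTapp, solution_r_of_eq_zero (hY a 0).1 i (obs_eq_zero (hY a 0).1 (hv0 a) i) hu',
      solution_m (hY a 0).1, prev_eq_zero (hY a 0).1 i hu' (hv0 a _), (hY a 0).2.1, map_zero,
      add_zero]
  have hGF (t) (ht : M (r i) (inner (m i)) (M (m i) (u i) t) = 0) : t = 0 := by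
    have hs : ∀ j < i, (Pi.single i t : Fin 10 → V) j = 0 :=
      fun j hj => Pi.single_eq_of_ne hj.ne _
    have := LinearMap.eq_zero_of_lowerTriangular T hT (fun a i ha => by
      rw [hTr a i fun j hj => ha j hj.le, ha i le_rfl, map_zero, map_zero]) i (Pi.single i t)
      hs (by rw [hTr _ _ hs, Pi.single_eq_same, ht])
    rwa [Pi.single_eq_same] at this
  have hF : Function.Surjective (M (m i) (u i)) :=
    LinearMap.surjective_of_ker fun t ht => hGF t (by rw [ht, map_zero])
  have hm : Y (0, b) (inner (m i)) = 0 := by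
    have hr := (h1 0 b).2 rfl i
    rw [solution_r_of_eq_zero (hY 0 b).1 i hobs fun j _ => hu0 b j] at hr
    obtain ⟨t, ht⟩ := hF (Y (0, b) (inner (m i)))
    rw [← ht] at hr
    rw [← ht, hGF t hr, map_zero]
  -- Only the message `target i` matters for `m i`, so the others may be replaced by zero.
  let b' : Fin 10 → V := Pi.single (target i) (b (target i))
  have hb' : b' (target i) = b (target i) := Pi.single_eq_same _ _
  have hm' : Y (0, b') (inner (m i)) = 0 := by
    have := m_eq_zero ((hY 0 b').1.sub (hY 0 b).1) i
      (fun j _ => by simp [hu0]) (by simp [(hY 0 _).2.2, hb'])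
    rwa [Pi.sub_apply, hm, sub_zero] at this
  have hnext (j l) (hl : prev l = inner (m j)) (hj : Y (0, b') (inner (m j)) = 0) :
      Y (0, b') (inner (m l)) = 0 := by
    rw [solution_m (hY 0 b').1, hu0, hl, hj]
    simp
  have hb0 : b' = 0 := by
    refine h2 b' fun l => ?_
    have key : ∀ i l, (toDest2 l = v l ∧ l ≠ target i) ∨ ∃ j, toDest2 l = inner (m j) ∧
        (target j ≠ target i ∨ j = i ∨ (j = 9 ∧ (i = 7 ∨ i = 8))) := by decide
    obtain ⟨h, hne⟩ | ⟨j, h, hne | rfl | ⟨rfl, rfl | rfl⟩⟩ := key i l <;> rw [h]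
    · rw [(hY 0 b').2.2]
      exact Pi.single_eq_of_ne hne _
    · refine m_eq_zero (hY 0 b').1 j (fun _ _ => hu0 _ _) ?_
      rw [(hY 0 b').2.2]
      exact Pi.single_eq_of_ne hne _
    · exact hm'
    · exact hnext 8 9 rfl (hnext 7 8 rfl hm')
    · exact hnext 8 9 rfl hm'
  rw [← hb', hb0]
  rfl

end Solution

/-- The Fano network forces characteristic two, and then the signals `x s`, `y s`, `z s` all vanish
for suitable private messages, whatever the message 7 is. -/
theorem not_linearlyZeroErrorAchievable :
    ¬ fanoNonFano.network.LinearlyZeroErrorAchievable (10 : ℕ) (10 : ℕ) := by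
  intro h
  obtain ⟨K, _, n, hn, M, Y, hY, h1, h2⟩ := WireSystem.exists_linear_rules h
  have key := decodable_of_obs (M := M) (Y := Y) hY h1 h2
  have hsol (b) : fanoNonFano.IsSolution M (Y (0, b)) := (hY 0 b).1
  have hv (b i) : Y (0, b) (v i) = b i := (hY 0 b).2.2 i
  have char_two (t : Fin n → K) : t + t = 0 := by
    refine add_self_eq_zero_of_fano (M fw (v 0)) (M fw (v 1)) (M fx (inner fw)) (M fx (v 2))
      (M fy (v 1)) (M fy (v 2)) (M fz (inner fw)) (M fz (inner fy)) ?_ ?_ ?_ t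
    · intro a b c hx hy
      refine key 0 ![a, b, c, 0, 0, 0, 0, 0, 0, 0] fun p hp => ?_
      have hp' : p = inner fx ∨ p = inner fy := by simpa [obs] using hp
      rcases hp' with rfl | rfl
      · rw [solution_fx (hsol _), solution_fw (hsol _), hv, hv, hv]
        exact hx
      · rw [solution_fy (hsol _), hv, hv]
        exact hy
    · intro a b c hx hz
      refine key 1 ![a, b, c, 0, 0, 0, 0, 0, 0, 0] fun p hp => ?_
      have hp' : p = inner fx ∨ p = inner fz := by simpa [obs] using hp
      rcases hp' with rfl | rfl
      · rw [solution_fx (hsol _), solution_fw (hsol _), hv, hv, hv]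
        exact hx
      · rw [solution_fz (hsol _), solution_fw (hsol _), solution_fy (hsol _), hv, hv, hv]
        exact hz
    · intro b c hz
      refine key 2 ![0, b, c, 0, 0, 0, 0, 0, 0, 0] fun p hp => ?_
      have hp' : p = v 0 ∨ p = inner fz := by simpa [obs] using hp
      rcases hp' with rfl | rfl
      · exact hv _ _
      · rw [solution_fz (hsol _), solution_fw (hsol _), solution_fy (hsol _), hv, hv, hv]
        change M fz (inner fw) (M fw (v 0) 0 + M fw (v 1) b) + _ = 0
        rw [map_zero, zero_add]
        exact hz
  have hBA : ∀ s, msgB s ≠ msgA s := by decide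
  have hCA : ∀ s, 7 ≠ msgA s := by decide
  have hCB : ∀ s, 7 ≠ msgB s := by decide
  have hx7 : ∀ s, ∃ i, obs i = {inner (w s), inner (x s)} ∧ target i = 7 := by decide
  have hyB : ∀ s, ∃ i, obs i = {inner (w s), inner (y s)} ∧ target i = msgB s := by decide
  have hzA : ∀ s, ∃ i, obs i = {inner (w s), inner (z s)} ∧ target i = msgA s := by decide
  have nonFano (s : Fin 2) (c : Fin n → K) : ∃ a b,
      M (x s) (v (msgA s)) a + M (x s) (v (msgB s)) b = 0 ∧
      M (y s) (v (msgA s)) a + M (y s) (v 7) c = 0 ∧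
      M (z s) (v (msgB s)) b + M (z s) (v 7) c = 0 := by
    let msg (a b c : Fin n → K) (i : Fin 10) : Fin n → K :=
      if i = msgA s then a else if i = msgB s then b else if i = 7 then c else 0
    have hA (a b c) : msg a b c (msgA s) = a := if_pos rfl
    have hB (a b c) : msg a b c (msgB s) = b :=
      (if_neg (hBA s)).trans (if_pos rfl)
    have hC (a b c) : msg a b c 7 = c :=
      (if_neg (hCA s)).trans <| (if_neg (hCB s)).trans (if_pos rfl)
    -- At `slot`, one message is decoded from `w s` and one further signal `q`.
    have two (slot : Fin 10) (q : Wire 10 Signal) (a b c : Fin n → K)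
        (hslot : obs slot = {inner (w s), q})
        (hw : M (w s) (v (msgA s)) a + M (w s) (v (msgB s)) b + M (w s) (v 7) c = 0)
        (hq : Y (0, msg a b c) q = 0) : msg a b c (target slot) = 0 := by
      refine key slot _ fun p hp => ?_
      rw [hslot, Finset.mem_insert, Finset.mem_singleton] at hp
      rcases hp with rfl | rfl
      · rwa [solution_w (hsol _), hv, hv, hv, hA, hB, hC]
      · exact hq
    refine exists_eq_zero_of_nonFano (A := M (w s) (v (msgA s))) (B := M (w s) (v (msgB s)))
      (C := M (w s) (v 7)) ?_ ?_ ?_ char_two c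
    · intro a b c hw hx
      obtain ⟨i, hi, ht⟩ := hx7 s
      rw [← hC a b c, ← ht]
      exact two i _ a b c hi hw (by rwa [solution_x (hsol _), hv, hv, hA, hB])
    · intro a b c hw hy
      obtain ⟨i, hi, ht⟩ := hyB s
      rw [← hB a b c, ← ht]
      exact two i _ a b c hi hw (by rwa [solution_y (hsol _), hv, hv, hA, hC])
    · intro a b c hw hz
      obtain ⟨i, hi, ht⟩ := hzA s
      rw [← hA a b c, ← ht]
      exact two i _ a b c hi hw (by rwa [solution_z (hsol _), hv, hv, hB, hC])
  have zero (c : Fin n → K) : c = 0 := by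
    obtain ⟨a₀, b₀, hx₀, hy₀, hz₀⟩ := nonFano 0 c
    obtain ⟨a₁, b₁, hx₁, hy₁, hz₁⟩ := nonFano 1 c
    refine key 9 ![0, 0, 0, a₀, b₀, a₁, b₁, c, 0, 0] fun p hp => ?_
    have hp' : p = inner (x 0) ∨ p = inner (y 0) ∨ p = inner (z 0) ∨ p = inner (x 1) ∨
        p = inner (y 1) ∨ p = inner (z 1) := by simpa [obs] using hp
    rcases hp' with rfl | rfl | rfl | rfl | rfl | rfl
    · rw [solution_x (hsol _), hv, hv]; exact hx₀
    · rw [solution_y (hsol _), hv, hv]; exact hy₀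
    · rw [solution_z (hsol _), hv, hv]; exact hz₀
    · rw [solution_x (hsol _), hv, hv]; exact hx₁
    · rw [solution_y (hsol _), hv, hv]; exact hy₁
    · rw [solution_z (hsol _), hv, hv]; exact hz₁
  exact one_ne_zero (congrFun (zero 1) ⟨0, hn⟩)

end Signal

/-! ### Codes from rules for the signals -/

namespace WireSystem

open TwoUnicastZ

/-- A code of block length 1 for the network of a wire system is given by rules `φ` for the signals
and decoding functions `g1`, `g2`. Here `val a b` are the values of the signals when the sources
emit their messages `a` and `b` uncoded, and each rule uses only the signals it has access to. -/
theorem zeroErrorAchievable_of_rules {k : ℕ} (S : WireSystem k) {A : Type} [Finite A] [Nontrivial A]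
    (φ : S.J → (Wire k S.J → A) → A) (val : (Fin k → A) → (Fin k → A) → Wire k S.J → A)
    (hu : ∀ a b i, val a b (.u i) = a i) (hv : ∀ a b i, val a b (.v i) = b i)
    (hφ : ∀ a b j f, (∀ x ∈ S.dep j, f x = val a b x) → φ j f = val a b (.inner j))
    (g1 : (Fin k → A) → Fin k → A) (g2 : (Fin k → A) → (Fin k → A) → Fin k → A)
    (h1 : ∀ a b, g1 (fun i => val a b (S.out1 i)) = a)
    (h2 : ∀ a b, g2 (fun i => val a b (S.out2 i)) a = b) :
    S.network.ZeroErrorAchievable k k := by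
  classical
  obtain ⟨d⟩ : Nonempty A := inferInstance
  have hk : ⌈((1 : ℕ) : ℝ≥0) * (k : ℝ≥0)⌉₊ = k := by simp
  let cast : Fin k ≃ Fin ⌈((1 : ℕ) : ℝ≥0) * (k : ℝ≥0)⌉₊ := finCongr hk.symm
  -- The inputs of an edge, extended by a default value to all edges.
  let ext (e : S.Edge) (inp : S.network.In e → Fin 1 → A) (e' : S.Edge) : A :=
    if h : e' ∈ S.network.In e then inp ⟨e', h⟩ 0 else d
  have hext (e : S.Edge) (X : S.Edge → Fin 1 → A) (e' : S.Edge) (h : e' ∈ S.network.In e) :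
      ext e (fun e' : S.network.In e => X e'.1) e' = X e' 0 := dif_pos h
  let rule : S.Edge → (S.Edge → A) → A
    | .wire (.inner j), f => φ j fun x => if h : x ∈ S.dep j then f (.copy x j h) else d
    | .copy x _ _, f => f (.wire x)
    | .into1 i, f => f (.wire (S.out1 i))
    | .into2 i, f => f (.wire (S.out2 i))
    | _, _ => d
  let emit : S.Edge → (Fin k → A) → A
    | .wire (.u i), a => a i
    | .wire (.v i), b => b i
    | _, _ => d
  let put : S.Edge → (S.Edge → A) → (Fin k → A) → A
    | .put1 i, f, _ => g1 (fun i' => f (.into1 i')) i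
    | .put2 i, f, a => g2 (fun i' => f (.into2 i')) a i
    | _, _, _ => d
  let c : S.network.Code A 1 k k :=
    { enc1 := fun e w _ => emit e.1 (w ∘ cast)
      enc2 := fun e w _ => emit e.1 (w ∘ cast)
      relay := fun e inp _ => rule e.1 (ext e.1 inp)
      dec1 := fun t inp _ => put t.1 (ext t.1 inp) fun _ => d
      dec2 := fun t inp _ => put t.1 (ext t.1 inp.1) (inp.2 ∘ cast)
      place1 := fun κ => (⟨Edge.put1 (cast.symm κ), by rw [T1_eq]; exact ⟨_, rfl⟩⟩, 0)
      place2 := fun κ => (⟨Edge.put2 (cast.symm κ), by rw [T2_eq]; exact ⟨_, rfl⟩⟩, 0) }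
  refine ⟨A, ‹_›, ‹_›, 1, one_pos, c, fun w1 w2 => ?_⟩
  let a := w1 ∘ cast
  let b := w2 ∘ cast
  let x : S.Edge → Fin 1 → A := fun e _ => match e with
    | .msg1 _ => d
    | .msg2 _ => d
    | .put1 i => a i
    | .put2 i => b i
    | .wire s => val a b s
    | .copy s _ _ => val a b s
    | .into1 i => val a b (S.out1 i)
    | .into2 i => val a b (S.out2 i)
  refine ⟨x, ⟨?_, ?_, ?_, ?_, ?_⟩, ?_, ?_⟩
  · rintro ⟨e, he⟩
    rw [Out1_eq] at he
    obtain ⟨i, rfl⟩ := he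
    funext l
    exact hu a b i
  · rintro ⟨e, he⟩
    rw [Out2_eq] at he
    obtain ⟨i, rfl⟩ := he
    funext l
    exact hv a b i
  · rintro ⟨e, he⟩
    funext l
    obtain ⟨j, rfl⟩ | ⟨s, j, h, rfl⟩ | ⟨i, rfl⟩ | ⟨i, rfl⟩ := (S.mem_relayEdge e).1 he
    · refine (hφ a b j _ fun s hs => ?_).symm
      rw [dif_pos hs]
      exact hext _ x (.copy s j hs) ((S.mem_In_inner j _).2 ⟨s, hs, rfl⟩)
    · exact (hext _ x (.wire s) ((S.mem_In_copy s j h _).2 rfl)).symm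
    · exact (hext _ x (.wire _) ((S.mem_In_into1 i _).2 rfl)).symm
    · exact (hext _ x (.wire _) ((S.mem_In_into2 i _).2 rfl)).symm
  · rintro ⟨t, ht⟩
    rw [T1_eq] at ht
    obtain ⟨i, rfl⟩ := ht
    funext l
    refine (congrFun (h1 a b) i).symm.trans (congrArg (fun f => g1 f i) ?_)
    funext i'
    exact (hext _ x (.into1 i') ((S.mem_In_put1 i _).2 ⟨i', rfl⟩)).symm
  · rintro ⟨t, ht⟩
    rw [T2_eq] at ht
    obtain ⟨i, rfl⟩ := ht
    funext l
    refine (congrFun (h2 a b) i).symm.trans (congrArg (fun f => g2 f a i) ?_)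
    funext i'
    exact (hext _ x (.into2 i') ((S.mem_In_put2 i _).2 ⟨i', rfl⟩)).symm
  · exact fun κ => congrArg w1 (cast.apply_symm_apply κ)
  · exact fun κ => congrArg w2 (cast.apply_symm_apply κ)

end WireSystem

/-! ### The non-linear code -/

namespace Signal

open Wire

/-- The message 7 enters the second copy of the non-Fano network with its two bits interchanged. -/
def twist (s : Fin 2) (c : BitVec 2) : BitVec 2 := if s = 0 then c else c.rotateLeft 1

theorem twist_twist : ∀ s c, twist s (twist s c) = c := by decide

/-- From a message modulo 4 and its bit reversal, each doubled, both bits can be read off. -/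
theorem twist_double : ∀ c : BitVec 2,
    twist 1 (c + c) + (twist 1 c + twist 1 c) = c := by decide

/-- The rules of the non-linear code over 2-bit words: the Fano network adds words bitwise, the
non-Fano networks and the masks add them modulo 4. -/
def rule (j : Signal) (f : Wire 10 Signal → BitVec 2) : BitVec 2 :=
  match j with
  | m i => f (u i) + f (prev i)
  | fw => f (v 0) ^^^ f (v 1)
  | fx => f (inner fw) ^^^ f (v 2)
  | fy => f (v 1) ^^^ f (v 2)
  | fz => f (inner fw) ^^^ f (inner fy)
  | w s => f (v (msgA s)) + f (v (msgB s)) + twist s (f (v 7))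
  | x s => f (v (msgA s)) + f (v (msgB s))
  | y s => f (v (msgA s)) + twist s (f (v 7))
  | z s => f (v (msgB s)) + twist s (f (v 7))
  | r 0 => f (inner (m 0)) - (f (inner fx) ^^^ f (inner fy))
  | r 1 => f (inner (m 1)) - (f (inner fx) ^^^ f (inner fz))
  | r 2 => f (inner (m 2)) - (f (v 0) ^^^ f (inner fz))
  | r 3 => f (inner (m 3)) - (f (inner (w 0)) - f (inner (z 0)))
  | r 4 => f (inner (m 4)) - (f (inner (w 0)) - f (inner (y 0)))
  | r 5 => f (inner (m 5)) - (f (inner (w 1)) - f (inner (z 1)))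
  | r 6 => f (inner (m 6)) - (f (inner (w 1)) - f (inner (y 1)))
  | r 7 => f (inner (m 7)) - (f (inner (w 0)) - f (inner (x 0)))
  | r 8 => f (inner (m 8)) - f (u 7) - twist 1 (f (inner (w 1)) - f (inner (x 1)))
  | r 9 => f (inner (m 9)) - f (u 7) - f (u 8) -
      (twist 1 (f (inner (y 0)) + f (inner (z 0)) - f (inner (x 0))) +
        (f (inner (y 1)) + f (inner (z 1)) - f (inner (x 1))))

/-- The values of the signals under the rules `rule`. -/
def val (a b : Fin 10 → BitVec 2) : Wire 10 Signal → BitVec 2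
  | u i => a i
  | v i => b i
  | .inner (m 8) => a 8 + (a 7 + b 7)
  | .inner (m 9) => a 9 + (a 8 + (a 7 + b 7))
  | .inner (m i) => a i + b i
  | .inner (r i) => a i
  | .inner fw => b 0 ^^^ b 1
  | .inner fx => b 0 ^^^ b 1 ^^^ b 2
  | .inner fy => b 1 ^^^ b 2
  | .inner fz => b 0 ^^^ b 2
  | .inner (w s) => b (msgA s) + b (msgB s) + twist s (b 7)
  | .inner (x s) => b (msgA s) + b (msgB s)
  | .inner (y s) => b (msgA s) + twist s (b 7)
  | .inner (z s) => b (msgB s) + twist s (b 7)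

theorem rule_eq_val (a b : Fin 10 → BitVec 2) (j : Signal) (f : Wire 10 Signal → BitVec 2)
    (hf : ∀ p ∈ dep j, f p = val a b p) : rule j f = val a b (inner j) := by
  have hx1 : ∀ p q r : BitVec 2, p ^^^ q ^^^ (q ^^^ r) = p ^^^ r := by decide
  have hx2 : ∀ p q r : BitVec 2, p ^^^ q ^^^ r ^^^ (q ^^^ r) = p := by decide
  have hx3 : ∀ p q r : BitVec 2, p ^^^ q ^^^ r ^^^ (p ^^^ r) = q := by decide
  have hx4 : ∀ p q : BitVec 2, p ^^^ (p ^^^ q) = q := by decide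
  cases j with
  | m i =>
    have hu := hf (u i) (by simp [dep])
    have hp := hf (prev i) (by simp [dep])
    simp only [rule, hu, hp]
    fin_cases i <;> rfl
  | r i =>
    have hd (p q c : BitVec 2) : p + c + (q + c) - (p + q) = c + c := by ring
    have h0 (c : BitVec 2) : twist 0 c = c := rfl
    fin_cases i <;> simp [dep, obs, side] at hf <;>
      simp [rule, hf, val, hx2, hx3, hx4, hd, h0, twist_twist, twist_double, msgA, msgB]
    · ring
    · ring
  | fw => simp [dep] at hf; simp [rule, hf, val]
  | fx => simp [dep] at hf; simp [rule, hf, val]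
  | fy => simp [dep] at hf; simp [rule, hf, val]
  | fz => simp [dep] at hf; simp [rule, hf, val, hx1]
  | w s => simp [dep] at hf; simp [rule, hf, val]
  | x s => simp [dep] at hf; simp [rule, hf, val]
  | y s => simp [dep] at hf; simp [rule, hf, val]
  | z s => simp [dep] at hf; simp [rule, hf, val]

/-- Destination 2 removes the masks, which it can compute from the message of source 1. -/
def decode2 (f a : Fin 10 → BitVec 2) : Fin 10 → BitVec 2
  | 7 => f 7 - (a 7 + a 8 + a 9)
  | 8 => f 8
  | 9 => f 9
  | i => f i - a i

theorem zeroErrorAchievable : fanoNonFano.network.ZeroErrorAchievable (10 : ℕ) (10 : ℕ) := by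
  have : Nontrivial (BitVec 2) := ⟨0, 1, by decide⟩
  refine fanoNonFano.zeroErrorAchievable_of_rules rule val (fun _ _ _ => rfl) (fun _ _ _ => rfl)
    rule_eq_val id decode2 (fun _ _ => rfl) fun a b => ?_
  funext i
  fin_cases i <;> simp [decode2, toDest2, val]
  ring

end Signal

theorem theorem5 :
    ∃ N : TwoUnicastZ,
      N.S1.ncard = 10 ∧ N.T1.ncard = 10 ∧ N.S2.ncard = 10 ∧ N.T2.ncard = 10 ∧
      N.ZeroErrorAchievable 10 10 ∧
      ¬ N.LinearlyZeroErrorAchievable 10 10 ∧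
      N.IsZeroErrorCapacity (10, 10) := by
  have h10 : ((10 : ℕ) : ℝ≥0) = 10 := by norm_num
  have h1 := Signal.zeroErrorAchievable
  have h2 := Signal.not_linearlyZeroErrorAchievable
  rw [h10] at h1 h2
  refine ⟨fanoNonFano.network, fanoNonFano.ncard_S1, fanoNonFano.ncard_T1, fanoNonFano.ncard_S2,
    fanoNonFano.ncard_T2, h1, h2, h1.isZeroErrorCapacity ?_ ?_⟩
  · rw [fanoNonFano.ncard_T1, h10]
  · rw [fanoNonFano.ncard_T2, h10]
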